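/- All graphs are finite. For a graph $G$, let $M(G)$ be its cycle matroid: the matroid on $E(G)$ whose circuits are the edge sets of the cycles of $G$. Let $M^*$ denote the dual of a matroid $M$. **Neighborhood-minors.** Let $G$ be a simple graph with vertex set $V$. An induced subgraph $H=G_W$ of $G$ is a *neighborhood-minor* of $G$ if $V=W\cup W'$ with $W\cap W'=\emptyset$, $W,W'\neq\emptyset$, and there is a vertex $v\in W$ with $W\cap N_G(W')\subseteq N_H[v]$, where $N_G(W')=\bigcup_{u\in W'}N_G(u)$ and $N_H[v]=N_H(v)\cup\{v\}$. **Generalized series minors.** Let $M$ be a binary matroid (i.e. one representable over $\mathbb F_2$) and let $E=\{e_1,\dots,e_s\}$, $E'=\{e'_1,\dots,e'_s\}$ be disjoint subsets of its ground set with $|E|=|E'|=s\geq 1$. Write $E_I=\{e_i : i\in I\}$ and $E'_I=\{e'_i: i\in I\}$ for $I\subseteq\{1,\dots,s\}$. The matroid $M/E'$ is a *binary matroidal retract* of $M$ if $E'$ is a circuit of $M$ and, for every circuit $C$ of $M$ and every proper subset $I\subsetneq\{1,\dots,s\}$, * $C\cap E'=E'_I$ implies $C\cap E=E_I$ or $C\cap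 E=E\setminus E_I$, and * $C\cap E=E_I$ implies $C\cap E'=E'_I$ or $C\cap E'=E'\setminus E'_I$. A matroid $M'$ is a *g-series minor* of a matroid $M$ if it is obtained from $M$ by a finite (possibly empty) sequence of deletions of elements, series contractions (contracting an element that lies in a $2$-element cocircuit), coloop contractions, and passages to binary matroidal retracts. **Cut algebras.** For a field $K$ and $A\subseteq V(G)$, let $\mathrm{Cut}(A)$ be the set of edges of $G$ with exactly one endpoint in $A$. The *cut algebra* of $G$ is the subalgebra $$K[\mathrm{Cut}(G)]=K\Big[z\prod_{e\in \mathrm{Cut}(A)}y_e \;:\; A\subseteq V(G)\Big]\subseteq K[y_e,z: e\in E(G)],$$ graded by $\deg z=1$, $\deg y_e=0$. A graded $K$-algebra $A$ is an *algebra retract* of a graded $K$-algebra $B$ if there are degree-preserving $K$-algebra homomorphisms $\iota\colon A\to B$ and $\gamma\colon B\to A$ with $\gamma\circ\iota=\mathrm{id}_A$. **Theorem.** Let $G$ be a finite simple graph, let $H$ be a neighborhood-minor of $G$, and let $K$ be a field. Then $M(H)^*$ is a g-series minor of $M(G)^*$. Moreover, $K[\mathrm{Cut}(H)]$ is an algebra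 retract of $K[\mathrm{Cut}(G)]$. -/

import Mathlib

/-! ### The cycle matroid of a simple graph -/

namespace SimpleGraph

/-- A set `I` of edges of `G` that contains the edge set of no cycle of `G`. -/
def IsCycleFree {V : Type*} (G : SimpleGraph V) (I : Set (Sym2 V)) : Prop :=
  I ⊆ G.edgeSet ∧ ∀ (v : V) (p : G.Walk v v), p.IsCycle → ¬ p.edgeSet ⊆ I

theorem isCycleFree_iff {V : Type*} (G : SimpleGraph V) (I : Set (Sym2 V)) :
    G.IsCycleFree I ↔ I ⊆ G.edgeSet ∧ (fromEdgeSet I).IsAcyclic := by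
  unfold IsCycleFree
  refine and_congr_right fun hI => ⟨fun h v c hc => ?_, fun h v p hp hsub => ?_⟩
  · have hle : fromEdgeSet I ≤ G := by
      intro a b hab
      exact hI ((fromEdgeSet_adj I).1 hab).1
    refine h v (c.mapLe hle) (hc.mapLe hle) ?_
    rw [Walk.edgeSet_mapLe_eq_edgeSet]
    intro e he
    have := c.edges_subset_edgeSet he
    rw [edgeSet_fromEdgeSet] at this
    exact this.1
  · have hp' : ∀ e ∈ p.edges, e ∈ (fromEdgeSet I).edgeSet := by
      intro e he
      rw [edgeSet_fromEdgeSet]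
      exact ⟨hsub he, G.not_isDiag_of_mem_edgeSet (p.edges_subset_edgeSet he)⟩
    exact h (p.transfer _ hp') (hp.transfer hp')

theorem fromEdgeSet_le_of_subset {V : Type*} {G : SimpleGraph V} {I : Set (Sym2 V)}
    (hI : I ⊆ G.edgeSet) : fromEdgeSet I ≤ G :=
  fun _ _ hab => hI ((fromEdgeSet_adj I).1 hab).1

theorem maximal_isCycleFree_iff {V : Type*} (G : SimpleGraph V) (I : Set (Sym2 V)) :
    Maximal G.IsCycleFree I ↔
      G.IsCycleFree I ∧ (fromEdgeSet I).Reachable = G.Reachable := by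
  constructor
  · intro h
    refine ⟨h.prop, ?_⟩
    have hI := (isCycleFree_iff G I).1 h.prop
    refine (maximal_isAcyclic_iff_reachable_eq (fromEdgeSet_le_of_subset hI.1) hI.2).1 ?_
    refine ⟨⟨fromEdgeSet_le_of_subset hI.1, hI.2⟩, fun F hF hle => ?_⟩
    have hF' : G.IsCycleFree F.edgeSet := by
      rw [isCycleFree_iff]
      exact ⟨edgeSet_mono hF.1, by rw [fromEdgeSet_edgeSet]; exact hF.2⟩
    have hIF : I ⊆ F.edgeSet := by
      intro e he
      have : e ∈ (fromEdgeSet I).edgeSet := by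
        rw [edgeSet_fromEdgeSet]
        exact ⟨he, G.not_isDiag_of_mem_edgeSet (hI.1 he)⟩
      exact edgeSet_mono hle this
    have := h.2 hF' hIF
    intro a b hab
    exact (fromEdgeSet_adj I).2 ⟨this hab, hab.ne⟩
  · rintro ⟨h, hr⟩
    have hI := (isCycleFree_iff G I).1 h
    have hm := (maximal_isAcyclic_iff_reachable_eq
      (fromEdgeSet_le_of_subset hI.1) hI.2).2 hr
    refine ⟨h, fun J hJ hIJ => ?_⟩
    have hJ' := (isCycleFree_iff G J).1 hJ
    have hle := hm.2 (y := fromEdgeSet J) ⟨fromEdgeSet_le_of_subset hJ'.1, hJ'.2⟩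
      (fromEdgeSet_mono hIJ)
    intro e he
    have : e ∈ (fromEdgeSet J).edgeSet := by
      rw [edgeSet_fromEdgeSet]
      exact ⟨he, G.not_isDiag_of_mem_edgeSet (hJ'.1 he)⟩
    have := edgeSet_mono hle this
    rw [edgeSet_fromEdgeSet] at this
    exact this.1

/-- The cycle matroid `M(G)`: its ground set is the edge set of `G`, and a set of edges is
independent iff it contains no edge set of a cycle. -/
def cycleMatroid {V : Type*} (G : SimpleGraph V) : Matroid (Sym2 V) :=
  IndepMatroid.matroid
  { E := G.edgeSet
    Indep := G.IsCycleFree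
    indep_empty := by
      rw [isCycleFree_iff]
      refine ⟨Set.empty_subset _, ?_⟩
      rw [fromEdgeSet_empty]
      exact isAcyclic_bot
    indep_subset := fun I J hJ hIJ =>
      ⟨hIJ.trans hJ.1, fun v p hp hs => hJ.2 v p hp (hs.trans hIJ)⟩
    indep_aug := by
      intro I B hI hnot hB
      by_contra! hcon
      refine hnot ((maximal_isCycleFree_iff G I).2 ⟨hI, ?_⟩)
      have hBr := ((maximal_isCycleFree_iff G B).1 hB).2
      have hI' := (isCycleFree_iff G I).1 hI
      have key : ∀ a b, (fromEdgeSet B).Adj a b → (fromEdgeSet I).Reachable a b := by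
        intro a b hab
        obtain ⟨habB, hne⟩ := (fromEdgeSet_adj B).1 hab
        by_cases habI : s(a, b) ∈ I
        · exact ((fromEdgeSet_adj I).2 ⟨habI, hne⟩).reachable
        · by_contra hr
          apply hcon _ ⟨habB, habI⟩
          rw [isCycleFree_iff]
          refine ⟨Set.insert_subset (hB.prop.1 habB) hI'.1, ?_⟩
          have := hI'.2.sup_edge_of_not_reachable hr
          convert this using 1
          rw [edge, ← fromEdgeSet_union, Set.union_singleton]
      funext a b
      apply propext
      constructor
      · exact fun h => h.mono (fromEdgeSet_le_of_subset hI'.1)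
      · intro h
        rw [← hBr] at h
        obtain ⟨p⟩ := h
        induction p with
        | nil => exact Reachable.refl _
        | cons hadj p ih => exact (key _ _ hadj).trans ih
    indep_maximal := by
      intro X hX I hI hIX
      have hI' := (isCycleFree_iff G I).1 hI
      obtain ⟨F, hIF, hF⟩ := exists_maximal_isAcyclic_of_le_isAcyclic
        (G := fromEdgeSet X) (fromEdgeSet_mono hIX) hI'.2
      have hFX : F.edgeSet ⊆ X := by
        intro e he
        have := edgeSet_mono hF.prop.1 he
        rw [edgeSet_fromEdgeSet] at this
        exact this.1
      refine ⟨F.edgeSet, ?_, ⟨?_, hFX⟩, ?_⟩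
      · intro e he
        have : e ∈ (fromEdgeSet I).edgeSet := by
          rw [edgeSet_fromEdgeSet]
          exact ⟨he, G.not_isDiag_of_mem_edgeSet (hI'.1 he)⟩
        exact edgeSet_mono hIF this
      · rw [isCycleFree_iff]
        exact ⟨hFX.trans hX, by rw [fromEdgeSet_edgeSet]; exact hF.prop.2⟩
      · rintro J ⟨hJ, hJX⟩ hle
        have hJ' := (isCycleFree_iff G J).1 hJ
        have h1 : F ≤ fromEdgeSet J := by
          intro a b hab
          exact (fromEdgeSet_adj J).2 ⟨hle hab, hab.ne⟩
        have h2 := hF.2 (y := fromEdgeSet J) ⟨fromEdgeSet_mono hJX, hJ'.2⟩ h1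
        intro e he
        have : e ∈ (fromEdgeSet J).edgeSet := by
          rw [edgeSet_fromEdgeSet]
          exact ⟨he, G.not_isDiag_of_mem_edgeSet (hJ'.1 he)⟩
        exact edgeSet_mono h2 this
    subset_ground := fun I hI => hI.1 }

@[simp]
theorem cycleMatroid_ground {V : Type*} (G : SimpleGraph V) :
    G.cycleMatroid.E = G.edgeSet := rfl

@[simp]
theorem cycleMatroid_indep_iff {V : Type*} (G : SimpleGraph V) (I : Set (Sym2 V)) :
    G.cycleMatroid.Indep I ↔ G.IsCycleFree I := Iff.rfl

/-- The circuits of `M(G)` are exactly the edge sets of the cycles of `G`. -/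
theorem cycleMatroid_isCircuit_iff {V : Type*} (G : SimpleGraph V) (C : Set (Sym2 V)) :
    G.cycleMatroid.IsCircuit C ↔
      ∃ (v : V) (p : G.Walk v v), p.IsCycle ∧ C = p.edgeSet := by
  have dep : ∀ (v : V) (p : G.Walk v v), p.IsCycle → G.cycleMatroid.Dep p.edgeSet :=
    fun v p hp => ⟨fun h => h.2 v p hp subset_rfl, fun e he => p.edges_subset_edgeSet he⟩
  have ex : ∀ D, G.cycleMatroid.Dep D →
      ∃ (v : V) (p : G.Walk v v), p.IsCycle ∧ p.edgeSet ⊆ D := by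
    rintro D ⟨hD, hDE⟩
    by_contra! hcon
    exact hD ⟨hDE, fun v p hp => hcon v p hp⟩
  constructor
  · intro hC
    obtain ⟨v, p, hp, hpC⟩ := ex C hC.prop
    exact ⟨v, p, hp, (hC.2 (dep v p hp) hpC).antisymm hpC⟩
  · rintro ⟨v, p, hp, rfl⟩
    refine ⟨dep v p hp, fun D hD hDp => ?_⟩
    obtain ⟨u, q, hq, hqD⟩ := ex D hD
    refine Set.Subset.trans ?_ hqD
    have hqp : q.edgeSet ⊆ p.edgeSet := hqD.trans hDp
    have hadj : ∀ {w : V} (r : G.Walk w w) (a b : V),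
        r.toSubgraph.Adj a b ↔ s(a, b) ∈ r.edgeSet := by
      intro w r a b
      rw [← Subgraph.mem_edgeSet, Walk.mem_edges_toSubgraph]
      rfl
    have hsub : ∀ a, q.toSubgraph.neighborSet a ⊆ p.toSubgraph.neighborSet a :=
      fun a b hb => (hadj p a b).2 (hqp ((hadj q a b).1 hb))
    have hsupp : ∀ a ∈ q.support, a ∈ p.support := by
      intro a ha
      have h2 := hq.ncard_neighborSet_toSubgraph_eq_two ha
      obtain ⟨b, hb⟩ : (q.toSubgraph.neighborSet a).Nonempty := by
        apply Set.nonempty_of_ncard_ne_zero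
        omega
      exact (p.mem_verts_toSubgraph).1 (p.toSubgraph.edge_vert (hsub a hb))
    have heq : ∀ a ∈ q.support,
        q.toSubgraph.neighborSet a = p.toSubgraph.neighborSet a := by
      intro a ha
      have h1 := hq.ncard_neighborSet_toSubgraph_eq_two ha
      have h2 := hp.ncard_neighborSet_toSubgraph_eq_two (hsupp a ha)
      refine Set.eq_of_subset_of_ncard_le (hsub a) (by omega) ?_
      apply Set.finite_of_ncard_ne_zero
      omega
    have hstep : ∀ a b, a ∈ q.support → p.toSubgraph.Adj a b → b ∈ q.support := by
      intro a b ha hab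
      have : b ∈ q.toSubgraph.neighborSet a := by rw [heq a ha]; exact hab
      exact (q.mem_verts_toSubgraph).1 (q.toSubgraph.edge_vert (Subgraph.Adj.symm this))
    have hu : u ∈ p.support := hsupp u q.start_mem_support
    have hall : ∀ a ∈ p.support, a ∈ q.support := by
      intro a ha
      have hconn := p.toSubgraph_connected
      obtain ⟨r⟩ := hconn.coe.preconnected
        ⟨u, p.mem_verts_toSubgraph.2 hu⟩ ⟨a, p.mem_verts_toSubgraph.2 ha⟩
      have gen : ∀ (x y : p.toSubgraph.verts), p.toSubgraph.coe.Walk x y →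
          (x : V) ∈ q.support → (y : V) ∈ q.support := by
        intro x y r
        induction r with
        | nil => exact id
        | cons h _ ih => exact fun hx => ih (hstep _ _ hx h)
      exact gen _ _ r q.start_mem_support
    intro e he
    induction e using Sym2.ind with
    | _ a b =>
      have hab := (hadj p a b).2 he
      have ha : a ∈ q.support :=
        hall a (p.mem_verts_toSubgraph.1 (p.toSubgraph.edge_vert hab))
      have : b ∈ q.toSubgraph.neighborSet a := by rw [heq a ha]; exact hab
      exact (hadj q a b).1 this

/-- The cycle matroid `M(H)` of a subgraph `H` of `G`, with the edges of `H` regarded as edges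
of `G`. -/
def Subgraph.cycleMatroid {V : Type*} {G : SimpleGraph V} (H : G.Subgraph) :
    Matroid (Sym2 V) :=
  H.coe.cycleMatroid.map (Sym2.map Subtype.val)
    (Sym2.map.injective Subtype.val_injective).injOn

/-- `H` is a neighborhood-minor of `G`: the vertex set of `G` is the disjoint union of non-empty
sets `W` and `W'`, `H` is the subgraph of `G` induced on `W`, and there is a vertex `v ∈ W` with
`W ∩ N_G(W') ⊆ N_H[v]`. -/
def Subgraph.IsNeighborhoodMinor {V : Type*} {G : SimpleGraph V} (H : G.Subgraph) : Prop :=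
  ∃ W W' : Set V, W.Nonempty ∧ W'.Nonempty ∧ W ∪ W' = Set.univ ∧ W ∩ W' = ∅ ∧
    H = (⊤ : G.Subgraph).induce W ∧
    ∃ v ∈ W, W ∩ (⋃ u ∈ W', G.neighborSet u) ⊆ insert v (H.neighborSet v)

end SimpleGraph

/-! ### Generalized series minors -/

namespace Matroid

/-- `M` is binary: it is the vector matroid of a matrix over the field with two elements, whose
columns are labelled by the elements of `M`. -/
def IsBinary {α : Type*} (M : Matroid α) : Prop :=
  ∃ (m : ℕ) (A : Matrix (Fin m) α (ZMod 2)),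
    ∀ I ⊆ M.E, M.Indep I ↔ LinearIndepOn (ZMod 2) A.col I

/-- `N = M / E'` is a binary matroidal retract of the binary matroid `M`. Here
`E = {e 0, …, e (s-1)}` and `E' = {e' 0, …, e' (s-1)}`, the set of indices of a sublist
`e_{i_1}, …, e_{i_p}` is `I`, and `p ≤ s - 1` says that `I` is not the whole index set. -/
def IsBinaryMatroidalRetract {α : Type*} (N M : Matroid α) : Prop :=
  M.IsBinary ∧ ∃ (s : ℕ) (e e' : Fin s → α), 1 ≤ s ∧
    Function.Injective e ∧ Function.Injective e' ∧
    Set.range e ⊆ M.E ∧ Set.range e' ⊆ M.E ∧ Disjoint (Set.range e) (Set.range e') ∧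
    M.IsCircuit (Set.range e') ∧
    (∀ C, M.IsCircuit C → ∀ I : Set (Fin s), I ≠ Set.univ →
      (C ∩ Set.range e' = e' '' I →
        C ∩ Set.range e = e '' I ∨ C ∩ Set.range e = Set.range e \ e '' I) ∧
      (C ∩ Set.range e = e '' I →
        C ∩ Set.range e' = e' '' I ∨ C ∩ Set.range e' = Set.range e' \ e' '' I)) ∧
    N = M ／ Set.range e'

/-- One of the four operations that are allowed in the formation of generalized series minors:
`IsGSeriesStep M N` says that `N` arises from `M` by one such operation. -/
inductive IsGSeriesStep {α : Type*} (M : Matroid α) : Matroid α → Prop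
  | deletion (e : α) : e ∈ M.E → IsGSeriesStep M (M ＼ {e})
  | seriesContraction (e f : α) : e ≠ f → M.IsCocircuit {e, f} → IsGSeriesStep M (M ／ {e})
  | coloopContraction (e : α) : M.IsColoop e → IsGSeriesStep M (M ／ {e})
  | binaryMatroidalRetract (N : Matroid α) :
      N.IsBinaryMatroidalRetract M → IsGSeriesStep M N

/-- `N` is a generalized series minor (g-series minor) of `M`: it is obtained from `M` by a
finite (possibly empty) sequence of the four operations. -/
def IsGSeriesMinor {α : Type*} (N M : Matroid α) : Prop :=
  Relation.ReflTransGen IsGSeriesStep M N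

end Matroid

/-! ### Cut algebras and algebra retracts -/

namespace SimpleGraph

/-- The cut set `Cut(A)`: the edges of `G` with exactly one endpoint in `A`. -/
def cutSet {V : Type*} (G : SimpleGraph V) (A : Set V) : Set G.edgeSet :=
  {e | ∃ a ∈ A, ∃ b ∉ A, (e : Sym2 V) = s(a, b)}

/-- The monomial `y^{Cut(A)} z` in the polynomial ring `K[y_e, z : e ∈ E(G)]`; the variable `y_e`
is `X (some e)` and `z` is `X none`. -/
noncomputable def cutMonomial (K : Type*) [Field K] {V : Type*} [Finite V] (G : SimpleGraph V)
    (A : Set V) : MvPolynomial (Option G.edgeSet) K :=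
  (∏ e ∈ (Set.toFinite (G.cutSet A)).toFinset, MvPolynomial.X (some e)) * MvPolynomial.X none

/-- The cut algebra `K[Cut(G)]`: the toric algebra of the cut polytope of `G`. -/
noncomputable def cutAlgebra (K : Type*) [Field K] {V : Type*} [Finite V] (G : SimpleGraph V) :
    Subalgebra K (MvPolynomial (Option G.edgeSet) K) :=
  Algebra.adjoin K (Set.range (G.cutMonomial K))

/-- The homogeneous component of degree `d` of the cut algebra, for the grading with
`deg z = 1` and `deg y_e = 0`. -/
noncomputable def cutAlgebraGrading (K : Type*) [Field K] {V : Type*} [Finite V]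
    (G : SimpleGraph V) (d : ℕ) : Submodule K (G.cutAlgebra K) :=
  (MvPolynomial.weightedHomogeneousSubmodule K
    (fun i : Option G.edgeSet => i.elim (1 : ℕ) (fun _ => 0)) d).comap
      (G.cutAlgebra K).val.toLinearMap

end SimpleGraph

/-- `A`, graded by `𝒜`, is an algebra retract of `B`, graded by `ℬ`: there are degree-preserving
`K`-algebra homomorphisms `ι : A → B` and `γ : B → A` with `γ ∘ ι = id`. -/
def IsAlgebraRetract {K A B : Type*} [Field K] [CommRing A] [Algebra K A] [CommRing B]
    [Algebra K B] (𝒜 : ℕ → Submodule K A) (ℬ : ℕ → Submodule K B) : Prop :=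
  ∃ (ι : A →ₐ[K] B) (γ : B →ₐ[K] A),
    (∀ d, ∀ a ∈ 𝒜 d, ι a ∈ ℬ d) ∧ (∀ d, ∀ b ∈ ℬ d, γ b ∈ 𝒜 d) ∧
    γ.comp ι = AlgHom.id K A

/-! ### Cut algebras -/

/-! Both statements rest on the map `f` that fixes `W` and collapses `W'` to `v`. The neighborhood
condition says precisely that an edge from `W'` to `W` becomes an edge of `H` or the single vertex
`v`.

For algebras, such a map pulls the monomial of `A` back to the monomial of the preimage of `A`
(`cutPullbackHom_cutMonomial`). The inclusion of `W` is another such map, and `f` after the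
inclusion is the identity, so the two pullbacks give the retract.

For matroids, the circuits of the dual of `M(G)` are the minimal non-empty cuts. The set `W'` is
removed one connected component `U` at a time (`isGSeriesMinor_within_compl`). Deletion in the dual
is contraction in `G`, so deleting the edges inside `U` makes `U` behave like one vertex.

If `U` has a neighbor `v`, or no neighbor outside `U` other than `v`, the edges inside `U ∪ {v}` are
deleted. Each remaining edge `uw` at `U` is then parallel to the surviving edge `vw` in the graph,
hence in series with it in the dual, and can be contracted.

Otherwise `v` is not adjacent to `U`. After parallel edges are discarded, the collapsed `U` has one
edge `e'` to each neighbor `w`, and `v` has an edge `e` to the same `w`. The edges `e'` form the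
minimal cut around `U`. Any cut that keeps `U` together meets the two families equally or
oppositely, according to whether it separates `U` from `v`. This is a binary matroidal retract. -/

open MvPolynomial in
/-- Substituting weighted homogeneous polynomials of the right degrees for the variables preserves
weighted homogeneity. -/
theorem MvPolynomial.IsWeightedHomogeneous.aeval_of_forall {R σ τ : Type*} [CommSemiring R]
    {w : σ → ℕ} {w' : τ → ℕ} {g : σ → MvPolynomial τ R}
    (hg : ∀ i, IsWeightedHomogeneous w' (g i) (w i)) {p : MvPolynomial σ R} {d : ℕ}
    (hp : IsWeightedHomogeneous w p d) : IsWeightedHomogeneous w' (aeval g p) d := by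
  rw [aeval_def, eval₂_eq]
  refine (weightedHomogeneousSubmodule R w' d).sum_mem fun m hm => ?_
  rw [mem_weightedHomogeneousSubmodule, ← hp (mem_support_iff.1 hm)]
  have h := IsWeightedHomogeneous.prod m.support (fun i => g i ^ m i) (fun i => m i * w i)
    (w := w') fun i _ => by simpa using (hg i).pow (m i)
  have h2 := (isWeightedHomogeneous_C w' (coeff m p)).mul h
  rw [zero_add] at h2
  simpa [Finsupp.weight_apply, Finsupp.sum] using h2

namespace SimpleGraph

variable {V X : Type*} {G : SimpleGraph V} {H : SimpleGraph X} {f : V → X}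

/-- The substitution of polynomial rings induced by a map of vertices: the variable of an edge goes
to the product of the variables of the edges above it. -/
noncomputable def cutPullbackHom (K : Type*) [Field K] [Finite V] (G : SimpleGraph V)
    (H : SimpleGraph X) (f : V → X) :
    MvPolynomial (Option H.edgeSet) K →ₐ[K] MvPolynomial (Option G.edgeSet) K :=
  MvPolynomial.aeval fun i => i.elim (MvPolynomial.X none) fun e =>
    ∏ e' ∈ (Set.toFinite {e' : G.edgeSet | Sym2.map f e' = e}).toFinset, MvPolynomial.X (some e')

theorem mem_cutSet_iff {A : Set V} {a b : V} (h : s(a, b) ∈ G.edgeSet) :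
    (⟨s(a, b), h⟩ : G.edgeSet) ∈ G.cutSet A ↔ ¬ (a ∈ A ↔ b ∈ A) := by
  constructor
  · rintro ⟨c, hc, d, hd, hcd⟩
    rcases Sym2.eq_iff.1 hcd with ⟨rfl, rfl⟩ | ⟨rfl, rfl⟩ <;> tauto
  · intro hab
    by_cases ha : a ∈ A
    · exact ⟨a, ha, b, by tauto, rfl⟩
    · exact ⟨b, by tauto, a, ha, Sym2.eq_swap⟩

/-- An edge `ab` is cut by the preimage of `A` exactly when `f a` and `f b` are separated by `A`;
then they differ, so they span an edge of `H`. The fibers over distinct edges are disjoint, so the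
product over the cut splits without repetition. -/
theorem cutPullbackHom_cutMonomial (K : Type*) [Field K] [Finite V] [Finite X]
    (hf : ∀ a b, G.Adj a b → f a ≠ f b → H.Adj (f a) (f b)) (A : Set X) :
    cutPullbackHom K G H f (H.cutMonomial K A) = G.cutMonomial K (f ⁻¹' A) := by
  classical
  simp only [cutMonomial, cutPullbackHom, map_mul, map_prod, MvPolynomial.aeval_X, Option.elim]
  congr 1
  rw [← Finset.prod_biUnion]
  · refine Finset.prod_congr ?_ fun _ _ => rfl
    ext ⟨e, he⟩
    induction e using Sym2.ind with
    | _ a b =>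
      simp only [Finset.mem_biUnion, Set.Finite.mem_toFinset, Set.mem_ofPred_eq, mem_cutSet_iff,
        Set.mem_preimage]
      constructor
      · rintro ⟨⟨e', he'⟩, h1, h2⟩
        simp only [Sym2.map_mk] at h2
        subst h2
        exact (mem_cutSet_iff he').1 h1
      · intro h
        have hne : f a ≠ f b := fun h' => h (by rw [h'])
        exact ⟨⟨s(f a, f b), hf a b he hne⟩, (mem_cutSet_iff _).2 h, rfl⟩
  · intro e _ e' _ hne
    rw [Function.onFun, Finset.disjoint_left]
    intro x hx hx'
    simp only [Set.Finite.mem_toFinset, Set.mem_ofPred_eq] at hx hx'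
    exact hne (Subtype.ext (hx.symm.trans hx'))

theorem cutPullbackHom_mem (K : Type*) [Field K] [Finite V] [Finite X]
    (hf : ∀ a b, G.Adj a b → f a ≠ f b → H.Adj (f a) (f b))
    (p : H.cutAlgebra K) : cutPullbackHom K G H f p ∈ G.cutAlgebra K := by
  have : H.cutAlgebra K ≤ (G.cutAlgebra K).comap (cutPullbackHom K G H f) := by
    refine Algebra.adjoin_le ?_
    rintro _ ⟨A, rfl⟩
    change cutPullbackHom K G H f (H.cutMonomial K A) ∈ G.cutAlgebra K
    rw [cutPullbackHom_cutMonomial K hf]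
    exact Algebra.subset_adjoin ⟨_, rfl⟩
  exact this p.2

/-- A map of vertices that sends every edge to an edge or to a single vertex induces a homomorphism
of cut algebras. -/
noncomputable def cutPullback (K : Type*) [Field K] [Finite V] [Finite X]
    (hf : ∀ a b, G.Adj a b → f a ≠ f b → H.Adj (f a) (f b)) :
    H.cutAlgebra K →ₐ[K] G.cutAlgebra K :=
  ((cutPullbackHom K G H f).comp (H.cutAlgebra K).val).codRestrict _ (cutPullbackHom_mem K hf)

theorem cutPullback_mem_grading (K : Type*) [Field K] [Finite V] [Finite X]
    (hf : ∀ a b, G.Adj a b → f a ≠ f b → H.Adj (f a) (f b)) (d : ℕ) (p : H.cutAlgebra K)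
    (hp : p ∈ H.cutAlgebraGrading K d) : cutPullback K hf p ∈ G.cutAlgebraGrading K d := by
  change MvPolynomial.IsWeightedHomogeneous _ (cutPullbackHom K G H f p) d
  refine MvPolynomial.IsWeightedHomogeneous.aeval_of_forall (w := fun i : Option H.edgeSet =>
    i.elim (1 : ℕ) (fun _ => 0)) ?_ hp
  rintro (_ | e)
  · exact MvPolynomial.isWeightedHomogeneous_X _ _ _
  · have := MvPolynomial.IsWeightedHomogeneous.prod
      (w := fun i : Option G.edgeSet => i.elim (1 : ℕ) (fun _ => 0))
      (Set.toFinite {e' : G.edgeSet | Sym2.map f e' = e}).toFinset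
      (fun e' => (MvPolynomial.X (some e') : MvPolynomial (Option G.edgeSet) K)) (fun _ => 0)
      (fun e' _ => MvPolynomial.isWeightedHomogeneous_X _ _ _)
    simpa using this

/-- If `H` is a retract of `G` under maps of vertices that send every edge to an edge or to a single
vertex, then the cut algebra of `H` is an algebra retract of the cut algebra of `G`. -/
theorem isAlgebraRetract_cutAlgebra (K : Type*) [Field K] [Finite V] [Finite X] {g : X → V}
    (hf : ∀ a b, G.Adj a b → f a ≠ f b → H.Adj (f a) (f b))
    (hg : ∀ a b, H.Adj a b → g a ≠ g b → G.Adj (g a) (g b)) (hfg : ∀ x, f (g x) = x) :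
    IsAlgebraRetract (H.cutAlgebraGrading K) (G.cutAlgebraGrading K) := by
  refine ⟨cutPullback K hf, cutPullback K hg, cutPullback_mem_grading K hf,
    cutPullback_mem_grading K hg, ?_⟩
  refine AlgHom.ext fun ⟨p, hp⟩ => Subtype.ext ?_
  change cutPullbackHom K H G g (cutPullbackHom K G H f p) = p
  suffices h : H.cutAlgebra K ≤
      AlgHom.equalizer ((cutPullbackHom K H G g).comp (cutPullbackHom K G H f)) (AlgHom.id K _) from
    h hp
  refine Algebra.adjoin_le ?_
  rintro _ ⟨A, rfl⟩
  change cutPullbackHom K H G g (cutPullbackHom K G H f (H.cutMonomial K A)) = H.cutMonomial K A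
  rw [cutPullbackHom_cutMonomial K hf, cutPullbackHom_cutMonomial K hg]
  congr 1
  ext x
  simp [hfg]

end SimpleGraph

/-! ### Binary matroids and generalized series minors -/

namespace Matroid

variable {α : Type*} {M N : Matroid α}

theorem isBinary_of_linearIndepOn {W : Type*} [AddCommGroup W] [Module (ZMod 2) W]
    [FiniteDimensional (ZMod 2) W] (φ : α → W)
    (h : ∀ I ⊆ M.E, M.Indep I ↔ LinearIndepOn (ZMod 2) φ I) : M.IsBinary := by
  let b := (Module.finBasis (ZMod 2) W).equivFun
  refine ⟨_, Matrix.of fun i e => b (φ e) i, fun I hI => ?_⟩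
  rw [h I hI]
  exact (b.toLinearMap.linearIndepOn_iff_of_injOn b.injective.injOn).symm

theorem IsBinary.delete (h : M.IsBinary) (D : Set α) : (M ＼ D).IsBinary := by
  obtain ⟨m, A, hA⟩ := h
  refine ⟨m, A, fun I hI => ?_⟩
  rw [delete_ground, Set.subset_sdiff] at hI
  rw [delete_indep_iff, hA I hI.1, and_iff_left hI.2]

/-- The representing vectors are taken modulo the span of a basis of `X`. -/
theorem IsBinary.contract (h : M.IsBinary) (X : Set α) : (M ／ X).IsBinary := by
  obtain ⟨m, A, hA⟩ := h
  obtain ⟨I, hI⟩ := M.exists_isBasis' X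
  refine isBinary_of_linearIndepOn
    ((Submodule.span (ZMod 2) (A.col '' I)).mkQ ∘ A.col) fun J hJ => ?_
  rw [contract_ground, Set.subset_sdiff] at hJ
  rw [hI.contract_indep_iff, and_iff_left hJ.2.symm, Set.union_comm,
    hA _ (Set.union_subset hI.indep.subset_ground hJ.1),
    ((hA I hI.indep.subset_ground).1 hI.indep).quotient_iff_union (hJ.2.symm.mono_left hI.subset)]

theorem IsGSeriesMinor.trans {P : Matroid α} (h : P.IsGSeriesMinor N) (h' : N.IsGSeriesMinor M) :
    P.IsGSeriesMinor M :=
  Relation.ReflTransGen.trans h' h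

theorem isGSeriesMinor_delete (M : Matroid α) {D : Set α} (hD : D.Finite) (hDM : D ⊆ M.E) :
    (M ＼ D).IsGSeriesMinor M := by
  induction D, hD using Set.Finite.induction_on with
  | empty => rw [delete_empty]; exact .refl
  | @insert e D he _ ih =>
    refine IsGSeriesMinor.trans ?_ (ih ((Set.subset_insert _ _).trans hDM))
    rw [← Set.union_singleton, ← delete_delete]
    exact .single (.deletion e ⟨hDM (Set.mem_insert _ _), he⟩)

/-- In the dual, `e` is either a loop or parallel to `f`. The first case is a coloop contraction,
the second a series contraction. -/
theorem isGSeriesStep_contractElem {e f : α} (hef : e ≠ f) (he : e ∈ M✶.closure {f}) :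
    M.IsGSeriesStep (M ／ {e}) := by
  by_cases hl : M✶.IsLoop e
  · exact .coloopContraction e (dual_isLoop_iff_isColoop.1 hl)
  · refine .seriesContraction e f hef ?_
    obtain ⟨C, hC, hCc, heC⟩ := exists_isCircuit_of_mem_closure he (by simpa using hef)
    rcases Set.subset_pair_iff_eq.1 hC with rfl | rfl | rfl | rfl
    · exact absurd heC (Set.notMem_empty e)
    · exact absurd (singleton_isCircuit.1 hCc) hl
    · exact absurd heC (by simpa using hef)
    · exact hCc

theorem isGSeriesMinor_contract {D : Set α} (hD : D.Finite) (M : Matroid α)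
    (h : ∀ e ∈ D, ∃ f ∉ D, e ∈ M✶.closure {f}) : (M ／ D).IsGSeriesMinor M := by
  induction D, hD using Set.Finite.induction_on generalizing M with
  | empty => rw [contract_empty]; exact .refl
  | @insert e D he _ ih =>
    obtain ⟨f, hf, hef⟩ := h e (Set.mem_insert _ _)
    have h1 : (M ／ {e}).IsGSeriesMinor M :=
      .single (isGSeriesStep_contractElem (fun h => hf (h ▸ Set.mem_insert _ _)) hef)
    refine IsGSeriesMinor.trans ?_ h1
    rw [← Set.singleton_union, ← contract_contract]
    refine ih _ fun e' he' => ?_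
    obtain ⟨f', hf', h'⟩ := h e' (Set.mem_insert_of_mem _ he')
    -- The witness lies outside the whole contracted set, so it survives each contraction and still
    -- serves in the remaining dual.
    refine ⟨f', fun h => hf' (Set.mem_insert_of_mem _ h), ?_⟩
    rw [dual_contract, delete_closure_eq_of_disjoint _
      (Set.disjoint_singleton.2 fun h : f' = e => hf' (h ▸ Set.mem_insert _ _))]
    exact ⟨h', fun h => he (h ▸ he')⟩

/-- A set is independent in `M ／ D` iff every circuit that it contains together with `D` already
lies in `D`. -/
theorem contract_indep_iff_forall_isCircuit {D I : Set α} (hI : I ⊆ M.E) (hID : Disjoint I D) :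
    (M ／ D).Indep I ↔ ∀ K, M.IsCircuit K → K ⊆ I ∪ D → K ⊆ D := by
  rw [indep_iff_forall_subset_not_isCircuit (Set.subset_sdiff.2 ⟨hI, hID⟩)]
  constructor
  · intro h K hK hKI
    by_contra hKD
    obtain ⟨C, hC, hCc⟩ := (hK.contract_dep_of_not_subset hKD).exists_isCircuit_subset
    exact h C (hC.trans (Set.sdiff_subset_iff.2 (Set.union_comm I D ▸ hKI))) hCc
  · intro h C hCI hC
    obtain ⟨K, hK, hCK, hKC⟩ := hC.exists_subset_isCircuit_of_contract
    have := hCK.trans (h K hK (hKC.trans (Set.union_subset_union_left _ hCI)))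
    obtain ⟨x, hx⟩ := hC.nonempty
    exact hID.le_bot ⟨hCI hx, this hx⟩

/-- If a set contains either exactly the same or exactly the opposite members of the two families
`e` and `e'`, then its intersections with them correspond to each other as in the definition of a
binary matroidal retract. -/
theorem inter_range_of_iff {s : ℕ} {e e' : Fin s → α} (he : e.Injective) (he' : e'.Injective)
    {C : Set α} {p : Prop} (h : ∀ i, e i ∈ C ↔ (e' i ∈ C ↔ p)) {I : Set (Fin s)}
    (hI : C ∩ Set.range e' = e' '' I) :
    C ∩ Set.range e = e '' I ∨ C ∩ Set.range e = Set.range e \ e '' I := by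
  have hI' : ∀ i, e' i ∈ C ↔ i ∈ I := fun i => by
    rw [← he'.mem_set_image, ← hI]
    exact ⟨fun h => ⟨h, i, rfl⟩, fun h => h.1⟩
  by_cases hp : p
  · refine .inl (Set.ext fun x => ⟨?_, ?_⟩)
    · rintro ⟨hx, i, rfl⟩
      exact ⟨i, (hI' i).1 (((h i).1 hx).2 hp), rfl⟩
    · rintro ⟨i, hi, rfl⟩
      exact ⟨(h i).2 (iff_of_true ((hI' i).2 hi) hp), i, rfl⟩
  · refine .inr (Set.ext fun x => ⟨?_, ?_⟩)
    · rintro ⟨hx, i, rfl⟩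
      exact ⟨⟨i, rfl⟩, fun hi => hp (((h i).1 hx).1 ((hI' i).2 ((he.mem_set_image).1 hi)))⟩
    · rintro ⟨⟨i, rfl⟩, hi⟩
      exact ⟨(h i).2 (iff_of_false (fun h' => hi ⟨i, (hI' i).1 h', rfl⟩) hp), i, rfl⟩

end Matroid

/-! ### Cuts and the dual of the cycle matroid -/

namespace SimpleGraph

variable {V : Type*} {G : SimpleGraph V}

/-- The set of edges of `G` with exactly one endpoint in `A`, as a set of unordered pairs of
vertices. -/
def cut (G : SimpleGraph V) (A : Set V) : Set (Sym2 V) :=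
  {e | e ∈ G.edgeSet ∧ ∃ a ∈ A, ∃ b ∉ A, e = s(a, b)}

theorem mk_mem_cut_iff {A : Set V} {a b : V} :
    s(a, b) ∈ G.cut A ↔ G.Adj a b ∧ ¬ (a ∈ A ↔ b ∈ A) := by
  refine and_congr Iff.rfl ⟨?_, fun hab => ?_⟩
  · rintro ⟨c, hc, d, hd, hcd⟩
    rcases Sym2.eq_iff.1 hcd with ⟨rfl, rfl⟩ | ⟨rfl, rfl⟩ <;> tauto
  · by_cases ha : a ∈ A
    · exact ⟨a, ha, b, by tauto, rfl⟩
    · exact ⟨b, by tauto, a, ha, Sym2.eq_swap⟩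

theorem cut_subset_edgeSet (G : SimpleGraph V) (A : Set V) : G.cut A ⊆ G.edgeSet :=
  fun _ h => h.1

theorem Reachable.mem_iff_mem {A : Set V} (hA : ∀ x y, G.Adj x y → (x ∈ A ↔ y ∈ A)) {a b : V}
    (h : G.Reachable a b) : a ∈ A ↔ b ∈ A := by
  obtain ⟨p⟩ := h
  induction p with
  | nil => rfl
  | cons h _ ih => exact (hA _ _ h).trans ih

/-- A path in `X` joining the ends of an edge outside `X` closes up with it to a cycle. -/
theorem mem_closure_cycleMatroid {X : Set (Sym2 V)} (hX : X ⊆ G.edgeSet) {a b : V}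
    (hab : G.Adj a b) (h : (fromEdgeSet X).Reachable a b) :
    s(a, b) ∈ G.cycleMatroid.closure X := by
  classical
  by_cases hmem : s(a, b) ∈ X
  · exact G.cycleMatroid.mem_closure_of_mem hmem hX
  obtain ⟨p, hp⟩ := h.symm.exists_isPath
  have hle := fromEdgeSet_le_of_subset hX
  have hpX : (p.mapLe hle).edgeSet ⊆ X := by
    rw [Walk.edgeSet_mapLe_eq_edgeSet]
    intro e he
    have := p.edges_subset_edgeSet he
    rw [edgeSet_fromEdgeSet] at this
    exact this.1
  refine (Matroid.mem_closure_iff_exists_isCircuit hmem).2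
    ⟨_, ?_, (cycleMatroid_isCircuit_iff G _).2 ⟨a, .cons hab (p.mapLe hle), ?_, rfl⟩, ?_⟩
  · intro e he
    rcases List.mem_cons.1 he with rfl | he
    · exact Set.mem_insert _ _
    · exact Set.mem_insert_of_mem _ (hpX he)
  · exact (Walk.cons_isCycle_iff _ hab).2 ⟨hp.mapLe hle, fun h => hmem (hpX h)⟩
  · exact List.mem_cons_self

/-- A set of edges is independent in the dual of the cycle matroid iff it contains no non-empty
cut. -/
theorem dual_cycleMatroid_indep_iff {I : Set (Sym2 V)} (hI : I ⊆ G.edgeSet) :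
    G.cycleMatroid✶.Indep I ↔ ∀ A, G.cut A ⊆ I → G.cut A = ∅ := by
  rw [← Matroid.coindep_def]
  constructor
  · intro h A hA
    -- A base connects whatever `G` connects, so it meets every non-empty cut; this one avoids `I`.
    obtain ⟨B, hB, hBI⟩ := h.exists_isBase_subset_compl
    have hr := ((maximal_isCycleFree_iff G B).1 (Matroid.isBase_iff_maximal_indep.1 hB)).2
    refine Set.eq_empty_of_forall_notMem fun e he => ?_
    induction e using Sym2.ind with
    | _ a b =>
      obtain ⟨hab, hne⟩ := mk_mem_cut_iff.1 he
      have hre : (fromEdgeSet B).Reachable a b := by rw [hr]; exact hab.reachable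
      refine hne (hre.mem_iff_mem fun x y hxy => ?_)
      by_contra hxyA
      have hxyB := ((fromEdgeSet_adj B).1 hxy).1
      exact (hBI hxyB).2 (hA (mk_mem_cut_iff.2 ⟨(hBI hxyB).1, hxyA⟩))
  · intro h
    rw [Matroid.coindep_iff_compl_spanning hI, Matroid.spanning_iff_ground_subset_closure]
    intro e he
    induction e using Sym2.ind with
    | _ a b =>
      refine mem_closure_cycleMatroid Set.sdiff_subset he ?_
      by_contra hr
      -- The component of `a` after removal of `I`: every edge leaving it belongs to `I`.
      have := h {x | (fromEdgeSet (G.edgeSet \ I)).Reachable a x} ?_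
      · exact Set.notMem_empty _ (this ▸ mk_mem_cut_iff.2
          ⟨he, fun h' => hr (h'.1 (Reachable.refl a))⟩)
      · intro e' he'
        induction e' using Sym2.ind with
        | _ x y =>
          obtain ⟨hxy, hne⟩ := mk_mem_cut_iff.1 he'
          by_contra hxyI
          have hadj : (fromEdgeSet (G.edgeSet \ I)).Adj x y :=
            (fromEdgeSet_adj _).2 ⟨⟨hxy, hxyI⟩, hxy.ne⟩
          exact hne ⟨fun h => h.trans hadj.reachable, fun h => h.trans hadj.symm.reachable⟩

theorem dual_cycleMatroid_dep_iff {D : Set (Sym2 V)} (hD : D ⊆ G.edgeSet) :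
    G.cycleMatroid✶.Dep D ↔ ∃ A, G.cut A ⊆ D ∧ (G.cut A).Nonempty := by
  rw [← Matroid.not_indep_iff hD, dual_cycleMatroid_indep_iff hD]
  simp [Set.nonempty_iff_ne_empty]

theorem exists_eq_cut_of_isCircuit {K : Set (Sym2 V)} (hK : G.cycleMatroid✶.IsCircuit K) :
    ∃ A, K = G.cut A := by
  obtain ⟨A, hAK, hA⟩ := (dual_cycleMatroid_dep_iff hK.subset_ground).1 hK.dep
  exact ⟨A, (hK.eq_of_dep_subset
    ((dual_cycleMatroid_dep_iff (G.cut_subset_edgeSet A)).2 ⟨A, subset_rfl, hA⟩) hAK).symm⟩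

theorem isCircuit_cut {A : Set V} (hA : (G.cut A).Nonempty)
    (h : ∀ B, G.cut B ⊆ G.cut A → (G.cut B).Nonempty → G.cut A ⊆ G.cut B) :
    G.cycleMatroid✶.IsCircuit (G.cut A) := by
  refine ⟨(dual_cycleMatroid_dep_iff (G.cut_subset_edgeSet A)).2 ⟨A, subset_rfl, hA⟩,
    fun D hD hDA => ?_⟩
  obtain ⟨B, hBD, hB⟩ := (dual_cycleMatroid_dep_iff hD.subset_ground).1 hD
  exact (h B (hBD.trans hDA) hB).trans hBD

theorem exists_isCircuit_of_mem_cut [Finite V] {A : Set V} {e : Sym2 V} (he : e ∈ G.cut A) :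
    ∃ K ⊆ G.cut A, G.cycleMatroid✶.IsCircuit K ∧ e ∈ K := by
  -- A cut minimal among those containing `e` is minimal among all non-empty cuts: if a non-empty
  -- cut inside it missed `e`, the symmetric difference would be a smaller cut containing `e`.
  obtain ⟨_, ⟨⟨heB, hBA⟩, B, rfl⟩, hmin⟩ := exists_minimal_of_wellFoundedLT
    (fun X => (e ∈ X ∧ X ⊆ G.cut A) ∧ ∃ B, X = G.cut B) ⟨G.cut A, ⟨he, subset_rfl⟩, A, rfl⟩
  refine ⟨_, hBA, isCircuit_cut ⟨e, heB⟩ fun B' hB' hne => ?_, heB⟩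
  by_cases heB' : e ∈ G.cut B'
  · exact hmin ⟨⟨heB', hB'.trans hBA⟩, B', rfl⟩ hB'
  · have hsymm : ∀ x, x ∈ G.cut (symmDiff B B') ↔ (x ∈ G.cut B ∧ x ∉ G.cut B') ∨
        (x ∈ G.cut B' ∧ x ∉ G.cut B) := by
      intro x
      induction x using Sym2.ind with
      | _ a b =>
        simp only [mk_mem_cut_iff, Set.mem_symmDiff]
        tauto
    have hsub : G.cut (symmDiff B B') ⊆ G.cut B := fun x hx =>
      ((hsymm x).1 hx).elim (fun h => h.1) (fun h => hB' h.1)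
    have := hmin (y := G.cut (symmDiff B B')) ⟨⟨(hsymm e).2 (.inl ⟨heB, heB'⟩),
      hsub.trans hBA⟩, _, rfl⟩ hsub
    obtain ⟨x, hx⟩ := hne
    exact (((hsymm x).1 (this (hB' hx))).elim (fun h => h.2 hx) (fun h => h.2 (hB' hx))).elim

/-- The coboundary map over the field with two elements: its range is the cut space. -/
noncomputable def coboundary (G : SimpleGraph V) :
    (V → ZMod 2) →ₗ[ZMod 2] (Sym2 V → ZMod 2) where
  toFun x := G.edgeSet.indicator (Sym2.lift ⟨fun a b => x a + x b, fun _ _ => add_comm _ _⟩)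
  map_add' x y := by
    funext e
    induction e using Sym2.ind with
    | _ a b =>
      by_cases h : s(a, b) ∈ G.edgeSet
      · simp only [Set.indicator_of_mem h, Pi.add_apply, Sym2.lift_mk]
        ring
      · simp only [Set.indicator_of_notMem h, Pi.add_apply, add_zero]
  map_smul' c x := by
    funext e
    induction e using Sym2.ind with
    | _ a b =>
      by_cases h : s(a, b) ∈ G.edgeSet
      · simp only [Set.indicator_of_mem h, Pi.smul_apply, Sym2.lift_mk, smul_eq_mul,
          RingHom.id_apply]
        ring
      · simp only [Set.indicator_of_notMem h, Pi.smul_apply, smul_zero]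

theorem coboundary_ne_zero_iff (x : V → ZMod 2) (e : Sym2 V) :
    G.coboundary x e ≠ 0 ↔ e ∈ G.cut {a | x a ≠ 0} := by
  induction e using Sym2.ind with
  | _ a b =>
    rw [mk_mem_cut_iff]
    by_cases h : s(a, b) ∈ G.edgeSet
    · rw [and_iff_right (show G.Adj a b from h)]
      change G.edgeSet.indicator _ _ ≠ 0 ↔ ¬ (x a ≠ 0 ↔ x b ≠ 0)
      rw [Set.indicator_of_mem h]
      change x a + x b ≠ 0 ↔ ¬ (x a ≠ 0 ↔ x b ≠ 0)
      generalize x a = p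
      generalize x b = q
      revert p q
      decide
    · refine iff_of_false (fun h' => h' ?_) (fun h' => h h'.1)
      exact Set.indicator_of_notMem h _

/-- Each edge is represented by its unit vector modulo the cut space. A linear dependency among
these vectors is then the indicator of a cut. -/
theorem dual_cycleMatroid_isBinary [Finite V] (G : SimpleGraph V) :
    G.cycleMatroid✶.IsBinary := by
  classical
  have := Fintype.ofFinite V
  refine Matroid.isBinary_of_linearIndepOn
    (fun e => (LinearMap.range G.coboundary).mkQ (Pi.single e 1)) fun I hI => ?_
  have hlc : ∀ l : Sym2 V →₀ ZMod 2, Finsupp.linearCombination (ZMod 2)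
      (fun e => (LinearMap.range G.coboundary).mkQ (Pi.single e 1)) l =
      (LinearMap.range G.coboundary).mkQ l := by
    intro l
    rw [Finsupp.linearCombination_apply, Finsupp.sum_fintype _ _ (by simp)]
    simp_rw [← map_smul, ← map_sum]
    congr 1
    funext e
    simp [Finset.sum_apply, Pi.single_apply]
  rw [dual_cycleMatroid_indep_iff hI, linearIndepOn_iff]
  simp_rw [hlc, Submodule.mkQ_apply, Submodule.Quotient.mk_eq_zero]
  constructor
  · rintro h l hl ⟨x, hx⟩
    have hx' : ∀ e, l e ≠ 0 ↔ e ∈ G.cut {a | x a ≠ 0} := fun e => by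
      rw [← coboundary_ne_zero_iff, hx]
    have := h {a | x a ≠ 0} fun e he =>
      (Finsupp.mem_supported _ _).1 hl (Finsupp.mem_support_iff.2 ((hx' e).2 he))
    ext e
    by_contra he
    exact Set.notMem_empty e (this ▸ (hx' e).1 he)
  · intro h A hA
    have hAx : {a | A.indicator (fun _ => (1 : ZMod 2)) a ≠ 0} = A := by
      ext a
      simp
    have key := coboundary_ne_zero_iff (G := G) (A.indicator fun _ => (1 : ZMod 2))
    rw [hAx] at key
    have h0 := h (Finsupp.equivFunOnFinite.symm (G.coboundary (A.indicator fun _ => 1)))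
      ((Finsupp.mem_supported _ _).2 fun e he =>
        hA ((key e).1 (Finsupp.mem_support_iff.1 he))) ⟨_, rfl⟩
    refine Set.eq_empty_of_forall_notMem fun e he => (key e).2 he ?_
    exact DFunLike.congr_fun h0 e

end SimpleGraph

/-! ### Removing the edges at a connected set of vertices -/

namespace SimpleGraph

open scoped Matroid

variable {V : Type*} {G : SimpleGraph V}

/-- The graph with the vertices of `G` and those edges of `G` that have both endpoints in `S`. -/
abbrev within (G : SimpleGraph V) (S : Set V) : SimpleGraph V :=
  ((⊤ : G.Subgraph).induce S).spanningCoe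

theorem within_adj {S : Set V} {a b : V} :
    (G.within S).Adj a b ↔ a ∈ S ∧ b ∈ S ∧ G.Adj a b := by
  simp

theorem mk_mem_edgeSet_within {S : Set V} {a b : V} :
    s(a, b) ∈ (G.within S).edgeSet ↔ a ∈ S ∧ b ∈ S ∧ G.Adj a b :=
  within_adj

theorem edgeSet_within_subset (G : SimpleGraph V) (S : Set V) :
    (G.within S).edgeSet ⊆ G.edgeSet :=
  edgeSet_mono fun _ _ h => (within_adj.1 h).2.2

/-- The side of the cut is constant along walks in `S`. Cuts that survive the deletion of the edges
inside `S` thus treat `S` as one vertex. -/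
theorem mem_iff_mem_of_disjoint_cut {A S : Set V}
    (hS : ∀ a ∈ S, ∀ b ∈ S, (G.within S).Reachable a b)
    (hA : Disjoint (G.cut A) (G.within S).edgeSet) {a b : V} (ha : a ∈ S) (hb : b ∈ S) :
    a ∈ A ↔ b ∈ A :=
  (hS a ha b hb).mem_iff_mem fun x y hxy => by
    by_contra h
    exact Set.disjoint_left.1 hA (mk_mem_cut_iff.2 ⟨(within_adj.1 hxy).2.2, h⟩) hxy

/-- The closure condition says that in `M(G) ／ C` the edge `e` is a loop or parallel to `f`; dually
it is a coloop or in series with `f`. -/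
theorem isGSeriesMinor_delete_contract [Finite V] {C D : Set (Sym2 V)} (hC : C ⊆ G.edgeSet)
    (hCD : Disjoint C D) (h : ∀ e ∈ D, ∃ f ∉ D, e ∈ G.cycleMatroid.closure (insert f C)) :
    (G.cycleMatroid✶ ＼ C ／ D).IsGSeriesMinor G.cycleMatroid✶ := by
  refine Matroid.IsGSeriesMinor.trans ?_
    (Matroid.isGSeriesMinor_delete _ (Set.toFinite C) (by simpa using hC))
  refine Matroid.isGSeriesMinor_contract (Set.toFinite D) _ fun e he => ?_
  obtain ⟨f, hf, hef⟩ := h e he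
  refine ⟨f, hf, ?_⟩
  rw [Matroid.dual_delete, Matroid.dual_dual, Matroid.contract_closure_eq, Set.singleton_union]
  exact ⟨hef, fun h => Set.disjoint_left.1 hCD h he⟩

/-- Deleting some edges within `U ∪ {v}` from the dual of the cycle matroid and contracting all
other edges that meet `U` has the same effect as removing all the edges that meet `U` from the
graph. -/
theorem delete_contract_eq_dual_within_compl [Finite V] {U : Set V} {v : V} (hv : v ∉ U)
    {C D : Set (Sym2 V)} (hE : C ∪ D = G.edgeSet \ (G.within Uᶜ).edgeSet)
    (hC : C ⊆ (G.within (insert v U)).edgeSet) :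
    G.cycleMatroid✶ ＼ C ／ D = (G.within Uᶜ).cycleMatroid✶ := by
  have hsub := G.edgeSet_within_subset Uᶜ
  have hdisj : Disjoint (G.within Uᶜ).edgeSet (C ∪ D) := hE ▸ Set.disjoint_sdiff_right
  rw [Set.disjoint_union_right] at hdisj
  have hcut : ∀ A, (G.within Uᶜ).cut A = G.cut A ∩ (G.within Uᶜ).edgeSet := by
    intro A
    ext e
    exact ⟨fun h => ⟨⟨hsub h.1, h.2⟩, h.1⟩, fun h => ⟨h.2, h.1.2⟩⟩
  have hground : (G.cycleMatroid✶ ＼ C ／ D).E = (G.within Uᶜ).edgeSet := by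
    change (G.edgeSet \ C) \ D = _
    rw [Set.sdiff_sdiff, hE, Set.sdiff_sdiff_cancel_left hsub]
  refine Matroid.ext_indep hground fun I hI => ?_
  rw [hground] at hI
  rw [dual_cycleMatroid_indep_iff hI, Matroid.contract_indep_iff_forall_isCircuit
    (show I ⊆ G.edgeSet \ C from Set.subset_sdiff.2 ⟨hI.trans hsub, hdisj.1.mono_left hI⟩)
    (hdisj.2.mono_left hI)]
  simp only [Matroid.delete_isCircuit_iff]
  constructor
  · intro h A hA
    refine Set.eq_empty_of_forall_notMem fun e he => ?_
    -- All of `U` is put on the side of `v`, so the extended cut uses no edge inside `U ∪ {v}`,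
    -- hence none of `C`.
    let A' := {x | (x ∈ U ∧ v ∈ A) ∨ (x ∉ U ∧ x ∈ A)}
    have heA' : ∀ e ∈ (G.within Uᶜ).edgeSet, e ∈ G.cut A' ↔ e ∈ G.cut A := by
      intro e he
      induction e using Sym2.ind with
      | _ a b =>
        obtain ⟨ha, hb, -⟩ := mk_mem_edgeSet_within.1 he
        rw [Set.mem_compl_iff] at ha hb
        simp only [mk_mem_cut_iff, A', Set.mem_ofPred_eq]
        tauto
    have hC' : Disjoint (G.cut A') C := by
      rw [Set.disjoint_left]
      intro e he heC
      have heC' := hC heC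
      induction e using Sym2.ind with
      | _ a b =>
        obtain ⟨ha, hb, -⟩ := mk_mem_edgeSet_within.1 heC'
        refine (mk_mem_cut_iff.1 he).2 ?_
        have : ∀ x ∈ insert v U, x ∈ A' ↔ v ∈ A := by
          rintro x (rfl | hx) <;> simp only [A', Set.mem_ofPred_eq] <;> tauto
        rw [this a ha, this b hb]
    rw [hcut] at he
    obtain ⟨K, hKA, hK, heK⟩ := exists_isCircuit_of_mem_cut ((heA' e he.2).2 he.1)
    have := h K ⟨hK, hC'.mono_left hKA⟩ fun x hx => by
      by_cases hxU : x ∈ (G.within Uᶜ).edgeSet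
      · exact .inl (hA ((hcut A).symm ▸ ⟨(heA' x hxU).1 (hKA hx), hxU⟩))
      · have hx' : x ∈ C ∪ D := hE ▸ ⟨hK.subset_ground hx, hxU⟩
        exact .inr (hx'.resolve_left fun hxC => Set.disjoint_left.1 hC' (hKA hx) hxC)
    exact Set.disjoint_left.1 hdisj.2 he.2 (this heK)
  -- Conversely, the trace of a cut of `G` on the edges avoiding `U` is a cut there; it lies in `I`,
  -- so it is empty.
  · rintro h K ⟨hK, hKC⟩ hKI x hx
    obtain ⟨A, rfl⟩ := exists_eq_cut_of_isCircuit hK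
    have hempty := h A fun y hy => by
      rw [hcut] at hy
      exact (hKI hy.1).resolve_right fun hyD => Set.disjoint_left.1 hdisj.2 hy.2 hyD
    have hx' : x ∈ C ∪ D := hE ▸ ⟨hx.1, fun hxU =>
      Set.notMem_empty x (hempty ▸ (hcut A).symm ▸ ⟨hx, hxU⟩)⟩
    exact hx'.resolve_left fun hxC => Set.disjoint_left.1 hKC hx hxC

theorem reachable_fromEdgeSet_insert {S : Set V} {a b c : V}
    (h : (G.within S).Reachable a b) (hbc : b ≠ c) :
    (fromEdgeSet (insert s(b, c) (G.within S).edgeSet)).Reachable a c := by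
  refine (h.mono fun x y hxy => ?_).trans
    ((fromEdgeSet_adj _).2 ⟨Set.mem_insert _ _, hbc⟩ : Adj _ b c).reachable
  exact (fromEdgeSet_adj _).2 ⟨Set.mem_insert_of_mem _ hxy, hxy.ne⟩

theorem isGSeriesMinor_within_compl_of_adj [Finite V] {U : Set V} {v : V} (hv : v ∉ U)
    (hU : ∀ a ∈ U, ∀ b ∈ U, (G.within U).Reachable a b)
    (hN : ∀ u ∈ U, ∀ w ∉ U, G.Adj u w → w = v ∨ G.Adj v w)
    (h : ∀ u ∈ U, ∀ w ∉ U, w ≠ v → G.Adj u w → ∃ u ∈ U, G.Adj u v) :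
    (G.within Uᶜ).cycleMatroid✶.IsGSeriesMinor G.cycleMatroid✶ := by
  have hCE : (G.within (insert v U)).edgeSet ⊆ G.edgeSet \ (G.within Uᶜ).edgeSet := by
    refine fun e he => ⟨G.edgeSet_within_subset _ he, fun he' => ?_⟩
    induction e using Sym2.ind with
    | _ a b =>
      obtain ⟨ha, hb, hab⟩ := mk_mem_edgeSet_within.1 he
      obtain ⟨ha', hb', -⟩ := mk_mem_edgeSet_within.1 he'
      exact hab.ne ((ha.resolve_right ha').trans (hb.resolve_right hb').symm)
  rw [← delete_contract_eq_dual_within_compl hv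
    (Set.union_sdiff_cancel hCE) subset_rfl]
  refine isGSeriesMinor_delete_contract (G.edgeSet_within_subset _) Set.disjoint_sdiff_right ?_
  -- Inside `U ∪ {v}` the vertex `u` is connected to `v`, so `uw` closes a cycle with `vw`, an edge
  -- that avoids `U` and is kept.
  have key : ∀ u w, u ∈ U → G.Adj u w → s(u, w) ∉ (G.within (insert v U)).edgeSet →
      ∃ f ∉ (G.edgeSet \ (G.within Uᶜ).edgeSet) \ (G.within (insert v U)).edgeSet,
        s(u, w) ∈ G.cycleMatroid.closure (insert f (G.within (insert v U)).edgeSet) := by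
    intro u w hu huw hC
    have hw : w ∉ insert v U := fun hw =>
      hC (mk_mem_edgeSet_within.2 ⟨Set.mem_insert_of_mem _ hu, hw, huw⟩)
    simp only [Set.mem_insert_iff, not_or] at hw
    have hvw := (hN u hu w hw.2 huw).resolve_left hw.1
    obtain ⟨u', hu', hu'v⟩ := h u hu w hw.2 hw.1 huw
    refine ⟨s(v, w), fun h => h.1.2 (mk_mem_edgeSet_within.2 ⟨hv, hw.2, hvw⟩),
      mem_closure_cycleMatroid (Set.insert_subset hvw (G.edgeSet_within_subset _)) huw ?_⟩
    refine reachable_fromEdgeSet_insert (((hU u hu u' hu').mono fun x y hxy => ?_).trans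
      (within_adj.2 ⟨Set.mem_insert_of_mem _ hu', Set.mem_insert _ _, hu'v⟩ :
        Adj _ u' v).reachable) hvw.ne
    obtain ⟨hx, hy, hxy⟩ := within_adj.1 hxy
    exact within_adj.2 ⟨Set.mem_insert_of_mem _ hx, Set.mem_insert_of_mem _ hy, hxy⟩
  intro e he
  induction e using Sym2.ind with
  | _ a b =>
    have hab : G.Adj a b := he.1.1
    by_cases ha : a ∈ U
    · exact key a b ha hab he.2
    · have hb : b ∈ U := by
        by_contra hb
        exact he.1.2 (mk_mem_edgeSet_within.2 ⟨ha, hb, hab⟩)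
      rw [Sym2.eq_swap] at he ⊢
      exact key b a hb hab.symm he.2

theorem isGSeriesMinor_within_compl_of_not_adj [Finite V] {U : Set V} {v : V} (hv : v ∉ U)
    (hU : ∀ a ∈ U, ∀ b ∈ U, (G.within U).Reachable a b)
    (hN : ∀ u ∈ U, ∀ w ∉ U, G.Adj u w → G.Adj v w)
    (hne : ∃ u ∈ U, ∃ w ∉ U, G.Adj u w) :
    (G.within Uᶜ).cycleMatroid✶.IsGSeriesMinor G.cycleMatroid✶ := by
  let T := {w | w ∉ U ∧ ∃ u ∈ U, G.Adj u w}
  have hT : ∀ w : T, ∃ u ∈ U, G.Adj u w := fun w => w.2.2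
  choose r hrU hr using hT
  have hvT : ∀ w : T, G.Adj v w := fun w => hN _ (hrU w) w w.2.1 (hr w)
  have hcutU : ∀ e, e ∈ G.cut U ↔ ∃ u ∈ U, ∃ w : T, G.Adj u w ∧ e = s(u, (w : V)) := by
    refine fun e => ⟨?_, ?_⟩
    · rintro ⟨he, a, ha, b, hb, rfl⟩
      exact ⟨a, ha, ⟨b, hb, a, ha, he⟩, he, rfl⟩
    · rintro ⟨u, hu, w, huw, rfl⟩
      exact ⟨huw, u, hu, w, w.2.1, rfl⟩
  let ι : Fin (Nat.card T) ≃ T := (Finite.equivFin T).symm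
  let e : Fin (Nat.card T) → Sym2 V := fun i => s(v, (ι i : V))
  let e' : Fin (Nat.card T) → Sym2 V := fun i => s(r (ι i), (ι i : V))
  have he : e.Injective := by
    intro i j hij
    rcases Sym2.eq_iff.1 hij with ⟨-, h⟩ | ⟨h, -⟩
    · exact ι.injective (Subtype.ext h)
    · exact absurd h (hvT _).ne
  have he' : e'.Injective := by
    intro i j hij
    rcases Sym2.eq_iff.1 hij with ⟨-, h⟩ | ⟨h, -⟩
    · exact ι.injective (Subtype.ext h)
    · exact absurd (h ▸ hrU (ι i)) (ι j).2.1
  have he'cut : Set.range e' ⊆ G.cut U := by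
    rintro _ ⟨i, rfl⟩
    exact (hcutU _).2 ⟨_, hrU _, _, hr _, rfl⟩
  set C := (G.within U).edgeSet with hCdef
  set D := G.cut U \ Set.range e' with hDdef
  have hCcut : Disjoint (G.cut U) C := by
    rw [Set.disjoint_left]
    rintro _ ⟨he, a, ha, b, hb, rfl⟩ h
    exact hb (mk_mem_edgeSet_within.1 h).2.1
  have hCD : Disjoint C D := (hCcut.mono_left Set.sdiff_subset).symm
  have hDe' : D ∪ Set.range e' = G.cut U := Set.sdiff_union_of_subset he'cut
  have hT0 : Nonempty T := by
    obtain ⟨u, hu, w, hw, huw⟩ := hne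
    exact ⟨⟨w, hw, u, hu, huw⟩⟩
  have hE : C ∪ G.cut U = G.edgeSet \ (G.within Uᶜ).edgeSet := by
    ext x
    induction x using Sym2.ind with
    | _ a b =>
      simp only [hCdef, Set.mem_union, within_adj, mk_mem_cut_iff, Set.mem_sdiff,
        mem_edgeSet, Set.mem_compl_iff]
      tauto
  have heC : ∀ i, e i ∉ C ∧ e i ∉ G.cut U := by
    refine fun i => ⟨fun h => hv (mk_mem_edgeSet_within.1 h).1, fun h => ?_⟩
    exact (mk_mem_cut_iff.1 h).2 (iff_of_false hv (ι i).2.1)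
  have hmin : (G.cycleMatroid✶ ＼ C ／ D).IsGSeriesMinor G.cycleMatroid✶ := by
    refine isGSeriesMinor_delete_contract (G.edgeSet_within_subset _) hCD ?_
    rintro x ⟨hx, hxe⟩
    obtain ⟨u, hu, w, huw, rfl⟩ := (hcutU x).1 hx
    refine ⟨s(r w, (w : V)), fun h => h.2 
      ⟨ι.symm w, congrArg (fun w : T => s(r w, (w : V))) (ι.apply_symm_apply w)⟩, ?_⟩
    exact mem_closure_cycleMatroid (Set.insert_subset (hr w) (G.edgeSet_within_subset _)) huw
      (reachable_fromEdgeSet_insert (hU u hu _ (hrU w)) (hr w).ne)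
  refine Matroid.IsGSeriesMinor.trans (.single (.binaryMatroidalRetract _ ?_)) hmin
  -- A cut inside the cut around `U` keeps `U` on one side. It also keeps `T` together with `v`, as
  -- the edges from `v` to `T` are not in the cut around `U`. If non-empty, it separates the two
  -- blocks and contains every edge between them.
  have hcirc : G.cycleMatroid✶.IsCircuit (G.cut U) := by
    refine isCircuit_cut ⟨_, he'cut ⟨ι.symm (Classical.arbitrary T), rfl⟩⟩ fun B hB hBne => ?_
    have hBU : ∀ {a b}, a ∈ U → b ∈ U → (a ∈ B ↔ b ∈ B) :=
      mem_iff_mem_of_disjoint_cut hU (hCcut.mono_left hB)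
    have hBT : ∀ w : T, v ∈ B ↔ (w : V) ∈ B := by
      intro w
      by_contra h
      exact (mk_mem_cut_iff.1 (hB (mk_mem_cut_iff.2 ⟨hvT w, h⟩))).2 (iff_of_false hv w.2.1)
    obtain ⟨x, hx⟩ := hBne
    obtain ⟨u, hu, w, huw, rfl⟩ := (hcutU x).1 (hB hx)
    have hx' := (mk_mem_cut_iff.1 hx).2
    intro y hy
    obtain ⟨u', hu', w', huw', rfl⟩ := (hcutU y).1 hy
    refine mk_mem_cut_iff.2 ⟨huw', ?_⟩
    rwa [hBU hu' hu, ← hBT w', hBT w]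
  have hiff : ∀ K, (G.cycleMatroid✶ ＼ C ／ D).IsCircuit K →
      ∃ p : Prop, ∀ i, e i ∈ K ↔ (e' i ∈ K ↔ p) := by
    intro K hK
    obtain ⟨K', hK', hKK', hK'D⟩ := hK.exists_subset_isCircuit_of_contract
    rw [Matroid.delete_isCircuit_iff] at hK'
    obtain ⟨A, rfl⟩ := exists_eq_cut_of_isCircuit hK'.1
    have hmem : ∀ x ∉ D, x ∈ K ↔ x ∈ G.cut A := fun x hx =>
      ⟨fun h => hKK' h, fun h => (hK'D h).resolve_right hx⟩
    have hAU : ∀ {a b}, a ∈ U → b ∈ U → (a ∈ A ↔ b ∈ A) :=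
      mem_iff_mem_of_disjoint_cut hU hK'.2
    obtain ⟨u, hu, -⟩ := hne
    -- If `U` and `v` lie on the same side, the edges to each `w` are both cut or both uncut;
    -- otherwise exactly one of them is cut.
    refine ⟨(u ∈ A ↔ v ∈ A), fun i => ?_⟩
    rw [hmem _ fun h => (heC i).2 h.1, hmem _ fun h => h.2 ⟨i, rfl⟩, mk_mem_cut_iff,
      mk_mem_cut_iff, and_iff_right (hvT _), and_iff_right (hr _), hAU (hrU _) hu]
    tauto
  refine ⟨((dual_cycleMatroid_isBinary G).delete C).contract D, Nat.card T, e, e', Nat.card_pos,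
    he, he', ?_, ?_, ?_, ?_, ?_, ?_⟩
  · rintro _ ⟨i, rfl⟩
    exact ⟨⟨hvT (ι i), (heC i).1⟩, fun h => (heC i).2 h.1⟩
  · rintro _ ⟨i, rfl⟩
    exact ⟨⟨hr (ι i), Set.disjoint_left.1 hCcut (he'cut ⟨i, rfl⟩)⟩, fun h => h.2 ⟨i, rfl⟩⟩
  · rw [Set.disjoint_left]
    rintro _ ⟨i, rfl⟩ h
    exact (heC i).2 (he'cut h)
  · have h1 : (G.cycleMatroid✶ ＼ C).IsCircuit (G.cut U) :=
      Matroid.delete_isCircuit_iff.2 ⟨hcirc, hCcut⟩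
    have h2 := h1.contract_isCircuit (C := D) (Set.ssubset_iff_subset_ne.2
      ⟨Set.sdiff_subset, fun h => ?_⟩)
    · rwa [hDdef, Set.sdiff_sdiff_cancel_left he'cut] at h2
    · have hmem := he'cut ⟨ι.symm (Classical.arbitrary T), rfl⟩
      rw [← h] at hmem
      exact hmem.2 ⟨_, rfl⟩
  · intro K hK I _
    obtain ⟨p, hp⟩ := hiff K hK
    exact ⟨Matroid.inter_range_of_iff he he' hp,
      Matroid.inter_range_of_iff (p := p) he' he fun i => by have := hp i; tauto⟩
  · rw [Matroid.contract_contract, hDe',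
      delete_contract_eq_dual_within_compl hv hE]
    refine edgeSet_mono fun x y hxy => ?_
    obtain ⟨hx, hy, hxy⟩ := within_adj.1 hxy
    exact within_adj.2 ⟨Set.mem_insert_of_mem _ hx, Set.mem_insert_of_mem _ hy, hxy⟩

theorem isGSeriesMinor_within_compl_of_reachable [Finite V] {U : Set V} {v : V} (hv : v ∉ U)
    (hU : ∀ a ∈ U, ∀ b ∈ U, (G.within U).Reachable a b)
    (hN : ∀ u ∈ U, ∀ w ∉ U, G.Adj u w → w = v ∨ G.Adj v w) :
    (G.within Uᶜ).cycleMatroid✶.IsGSeriesMinor G.cycleMatroid✶ := by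
  by_cases h : ∀ u ∈ U, ∀ w ∉ U, w ≠ v → G.Adj u w → ∃ u ∈ U, G.Adj u v
  · exact isGSeriesMinor_within_compl_of_adj hv hU hN h
  · push Not at h
    obtain ⟨u, hu, w, hw, hwv, huw, hvU⟩ := h
    refine isGSeriesMinor_within_compl_of_not_adj hv hU (fun a ha b hb hab => ?_)
      ⟨u, hu, w, hw, huw⟩
    refine (hN a ha b hb hab).resolve_left ?_
    rintro rfl
    exact hvU a ha hab

theorem isGSeriesMinor_within_compl [Finite V] (G : SimpleGraph V) {U : Set V} {v : V}
    (hv : v ∉ U) (hN : ∀ u ∈ U, ∀ w ∉ U, G.Adj u w → w = v ∨ G.Adj v w) :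
    (G.within Uᶜ).cycleMatroid✶.IsGSeriesMinor G.cycleMatroid✶ := by
  induction hn : U.ncard using Nat.strong_induction_on generalizing G U with
  | _ n ih =>
    rcases U.eq_empty_or_nonempty with rfl | ⟨u, hu⟩
    · have : G.within ∅ᶜ = G := by
        ext a b
        simp
      rw [this]
      exact .refl
    -- The component of `u` in the graph on `U`. Its neighbors outside itself lie outside `U`, so it
    -- inherits the condition on `v`.
    · let U₁ := {x | x ∈ U ∧ (G.within U).Reachable u x}
      have hreach : ∀ x, (G.within U).Reachable u x → (G.within U₁).Reachable u x := by
        intro x hx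
        rw [reachable_iff_reflTransGen] at hx
        induction hx with
        | refl => exact Reachable.refl _
        | @tail y z hy hyz ih =>
          have hy' := reachable_iff_reflTransGen _ _ |>.2 hy
          obtain ⟨hyU, hzU, hyz'⟩ := within_adj.1 hyz
          exact ih.trans ((within_adj (S := U₁)).2
            ⟨⟨hyU, hy'⟩, ⟨hzU, hy'.trans hyz.reachable⟩, hyz'⟩ :
            Adj _ y z).reachable
      have h₁ : (G.within U₁ᶜ).cycleMatroid✶.IsGSeriesMinor G.cycleMatroid✶ := by
        refine isGSeriesMinor_within_compl_of_reachable (v := v) (fun h => hv h.1)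
          (fun a ha b hb => (hreach a ha.2).symm.trans (hreach b hb.2)) fun a ha w hw haw => ?_
        refine hN a ha.1 w (fun hwU => hw ⟨hwU, ha.2.trans ?_⟩) haw
        exact (within_adj.2 ⟨ha.1, hwU, haw⟩ : Adj _ a w).reachable
      have hsub : (U \ U₁) ⊂ U := Set.ssubset_iff_subset_ne.2 ⟨Set.sdiff_subset, fun h =>
        (h.symm ▸ hu : u ∈ U \ U₁).2 ⟨hu, Reachable.refl _⟩⟩
      have h₂ := ih _ (hn ▸ Set.ncard_lt_ncard hsub) (G := G.within U₁ᶜ) (fun h => hv h.1)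
        (fun a ha w hw haw => ?_) rfl
      · have : (G.within U₁ᶜ).within (U \ U₁)ᶜ = G.within Uᶜ := by
          ext a b
          simp only [within_adj, Set.mem_compl_iff, Set.mem_sdiff]
          have h1 : ∀ x, x ∉ U → x ∉ U₁ := fun x hx h => hx h.1
          have := h1 a
          have := h1 b
          tauto
        rw [this] at h₂
        exact h₂.trans h₁
      · obtain ⟨-, hw₁, haw'⟩ := within_adj.1 haw
        refine (hN a ha.1 w (fun h => hw ⟨h, hw₁⟩) haw').imp_right fun h => ?_
        exact within_adj.2 ⟨fun h => hv h.1, hw₁, h⟩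

/-! ### The cycle matroid of a subgraph -/

/-- Every edge of the walk has its ends in `H.verts`, so a walk starting there never leaves. -/
theorem Subgraph.exists_map_eq {H : G.Subgraph} {a b : V} (p : H.spanningCoe.Walk a b)
    (ha : a ∈ H.verts) : ∃ (hb : b ∈ H.verts) (q : H.coe.Walk ⟨a, ha⟩ ⟨b, hb⟩),
      q.map (⟨Subtype.val, fun h => h⟩ : H.coe →g H.spanningCoe) = p := by
  induction p with
  | nil => exact ⟨ha, .nil, rfl⟩
  | @cons a c b h p ih =>
    obtain ⟨hb, q, rfl⟩ := ih (H.edge_vert (Subgraph.Adj.symm h))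
    exact ⟨hb, .cons (show H.coe.Adj ⟨a, ha⟩ ⟨c, _⟩ from h) q, rfl⟩

theorem Subgraph.cycleMatroid_eq (H : G.Subgraph) :
    H.cycleMatroid = H.spanningCoe.cycleMatroid := by
  let φ : H.coe →g H.spanningCoe := ⟨Subtype.val, fun h => h⟩
  have hφ : Function.Injective φ := Subtype.val_injective
  have hinj := Sym2.map.injective hφ
  have hedge : Sym2.map φ '' H.coe.edgeSet = H.spanningCoe.edgeSet := by
    ext e
    induction e using Sym2.ind with
    | _ a b =>
      constructor
      · rintro ⟨e, he, h⟩
        induction e using Sym2.ind with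
        | _ x y => exact h ▸ φ.map_adj he
      · intro h
        exact ⟨s(⟨a, H.edge_vert h⟩, ⟨b, H.edge_vert (Subgraph.Adj.symm h)⟩), h, rfl⟩
  have hwalk : ∀ {x y} (p : H.coe.Walk x y), (p.map φ).edgeSet = Sym2.map φ '' p.edgeSet := by
    intro x y p
    ext e
    simp [Walk.edgeSet]
  refine Matroid.ext_indep hedge fun I hI => ?_
  rw [Subgraph.cycleMatroid, Matroid.map_indep_iff]
  simp only [cycleMatroid_indep_iff]
  change (∃ I₀, H.coe.IsCycleFree I₀ ∧ I = Sym2.map φ '' I₀) ↔ H.spanningCoe.IsCycleFree I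
  constructor
  · rintro ⟨I₀, hI₀, rfl⟩
    refine ⟨hedge ▸ Set.image_mono hI₀.1, fun v p hp hpI => ?_⟩
    -- A cycle has a first edge, so it cannot be based at one of the isolated vertices added by
    -- `spanningCoe`.
    have hv : v ∈ H.verts := by
      cases p with
      | nil => exact absurd rfl hp.ne_nil
      | cons h p => exact H.edge_vert h
    obtain ⟨hv, q, rfl⟩ := Subgraph.exists_map_eq p hv
    refine hI₀.2 _ q ((Walk.isCycle_map_iff_of_injective hφ).1 hp) ?_
    rw [hwalk] at hpI
    exact (Set.image_subset_image_iff hinj).1 hpI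
  · rintro ⟨hIE, hI⟩
    obtain ⟨I₀, hI₀, rfl⟩ := Set.subset_image_iff.1 (hedge ▸ hIE)
    refine ⟨I₀, ⟨hI₀, fun v p hp hpI => ?_⟩, rfl⟩
    refine hI _ (p.map φ) ((Walk.isCycle_map_iff_of_injective hφ).2 hp) ?_
    rw [hwalk]
    exact Set.image_mono hpI

end SimpleGraph

theorem mainTheorem4 {V : Type*} [Finite V] (G : SimpleGraph V) (H : G.Subgraph)
    (hH : H.IsNeighborhoodMinor) (K : Type*) [Field K] :
    (H.cycleMatroid)✶.IsGSeriesMinor (G.cycleMatroid)✶ ∧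
    IsAlgebraRetract (H.coe.cutAlgebraGrading K) (G.cutAlgebraGrading K) := by
  classical
  obtain ⟨W, W', -, -, hunion, hinter, rfl, v, hv, hN⟩ := hH
  obtain rfl : W = W'ᶜ := (IsCompl.of_eq hinter hunion).eq_compl
  have hN' : ∀ u ∈ W', ∀ w ∉ W', G.Adj u w → w = v ∨ G.Adj v w := by
    intro u hu w hw huw
    refine (hN ⟨hw, Set.mem_biUnion hu huw⟩).imp_right fun h => ?_
    exact h.2.2
  refine ⟨?_, ?_⟩
  · rw [SimpleGraph.Subgraph.cycleMatroid_eq]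
    exact G.isGSeriesMinor_within_compl hv hN'
  -- The retraction that collapses `W'` to `v`.
  · let f : V → ((⊤ : G.Subgraph).induce W'ᶜ).verts := fun x =>
      if hx : x ∈ W' then ⟨v, hv⟩ else ⟨x, hx⟩
    refine SimpleGraph.isAlgebraRetract_cutAlgebra K (f := f) (g := Subtype.val) ?_ ?_ ?_
    · intro a b hab hne
      by_cases ha : a ∈ W' <;> by_cases hb : b ∈ W' <;> simp only [f, ha, hb, dite_true,
        dite_false, ne_eq, not_true_eq_false] at hne ⊢
      · exact ⟨hv, hb, (hN' a ha b hb hab).resolve_left fun h => hne (Subtype.ext h.symm)⟩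
      · exact ⟨ha, hv, ((hN' b hb a ha hab.symm).resolve_left fun h => hne (Subtype.ext h)).symm⟩
      · exact ⟨ha, hb, hab⟩
    · exact fun a b hab _ => hab.2.2
    · rintro ⟨x, hx⟩
      exact dif_neg hx
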